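/- Let $n\ge 0$ and $p\ge 1$ be integers. There are $n$ agents and $p$ pairwise disjoint sets $D_1,\dots,D_p$ of items, $D_i$ consisting of $n$ items of type $i$, and one unit of each item $o\in M=D_1\cup\dots\cup D_p$ is available. A bundle is an element of $\mathcal D=D_1\times\dots\times D_p$; write $o\in\mathbf x$ if the bundle $\mathbf x$ contains the item $o$. A profile $R=(\succ_j)_{j\le n}$ gives each agent $j$ a strict linear order $\succ_j$ on $\mathcal D$. A fractional assignment is a matrix $P=(p_{j,\mathbf x})_{j\le n,\mathbf x\in\mathcal D}$ with entries in $[0,1]$ such that $\sum_{\mathbf x}p_{j,\mathbf x}=1$ for every agent $j$ and $\sum_{j}\sum_{\mathbf x\ni o}p_{j,\mathbf x}=1$ for every item $o$. A mechanism $f$ maps each profile $R$ to a fractional assignment $f(R)$. Put $$u^P_{j,\mathbf x}=p_{j,\mathbf x}+\sum_{\hat{\mathbf x}\succ_j\mathbf x}p_{j,\hat{\mathbf x}},$$ the cumulative share of agent $j$ over the upper contour set of $\mathbf x$. * $P$ is leximin-optimal for $R$ if for every fractional assignment $Q\ne P$, when the vectors $u^P$ and $u^Q$ (indexed by all pairs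 $(j,\mathbf x)$) are sorted in ascending order, there is a position at which the sorted $u^P$ is strictly larger than the sorted $u^Q$, and at all earlier positions it is at least as large. * $P$ is item-wise ordinally fair for $R$ if for every agent $j$ and every bundle $\mathbf x$ there is an item $o\in\mathbf x$ such that for every agent $k$ and every bundle $\hat{\mathbf x}$ with $o\in\hat{\mathbf x}$ and $p_{k,\hat{\mathbf x}}>0$ we have $u^P_{k,\hat{\mathbf x}}\le u^P_{j,\mathbf x}$. A mechanism satisfies leximin-optimality (item-wise ordinal fairness) if $f(R)$ is leximin-optimal (item-wise ordinally fair) for $R$, for every profile $R$. The multi-type probabilistic serial mechanism MPS starts with all items unexhausted, one unit of supply of each item, and all shares zero, and proceeds in rounds as long as some item is unexhausted. In each round, every agent determines her most preferred bundle among those all of whose items are unexhausted, and consumes it, that is, every item in it, at rate one unit per unit of time. The round ends as soon as one of the items being consumed is exhausted; the shares and supplies are updated, and the items exhausted in this round are removed. The output is the matrix of the shares consumed. Theorem. For every profile, MPS terminates after at most $np$ rounds with all items exhausted, and its output is a fractional assignment, so MPS is a mechanism. Moreover: (I) MPS satisfies leximin-optimality, and it is the only mechanism that does. (II) MPS satisfies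 item-wise ordinal fairness, and it is the only mechanism that does. -/

import Mathlib

/-! Multi-type assignment problems with `n` agents and `p` types, with `n` items of each type. -/

namespace MTAP

/-- The pair `(i, a)` is the item of type `i` with label `a`. -/
abbrev Item (n p : ℕ) : Type := Fin p × Fin n

/-- A bundle consists of one item of each type: `x i` is the label of its item of type `i`. -/
abbrev Bundle (n p : ℕ) : Type := Fin p → Fin n

/-- The bundle `x` contains the item `o`. -/
def Contains {n p : ℕ} (x : Bundle n p) (o : Item n p) : Prop := x o.1 = o.2

/-- A strict linear preference over bundles; `pref.better x y` reads `x ≻ y`. -/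
structure Preference (n p : ℕ) where
  better : Bundle n p → Bundle n p → Prop
  irrefl : ∀ x, ¬ better x x
  trans : ∀ x y z, better x y → better y z → better x z
  total : ∀ x y, x ≠ y → better x y ∨ better y x

/-- A preference profile: one strict linear preference for each agent. -/
abbrev Profile (n p : ℕ) : Type := Fin n → Preference n p

/-- An agents × bundles matrix of shares. -/
abbrev ShareMatrix (n p : ℕ) : Type := Fin n → Bundle n p → ℝ

open Classical in
/-- Fractional assignments: shares lie in `[0,1]`, each agent receives total share one, and
each item is allocated exactly once in total. -/
def IsAssignment {n p : ℕ} (P : ShareMatrix n p) : Prop :=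
  (∀ j x, 0 ≤ P j x ∧ P j x ≤ 1) ∧
  (∀ j, ∑ x, P j x = 1) ∧
  (∀ o : Item n p, ∑ j, ∑ x with Contains x o, P j x = 1)

/-- A mechanism maps every profile to a fractional assignment. -/
def IsMechanism {n p : ℕ} (f : Profile n p → ShareMatrix n p) : Prop :=
  ∀ R, IsAssignment (f R)

/-- The upper contour set of `x`: all bundles better than `x`, and `x` itself. -/
def upperContour {n p : ℕ} (pref : Preference n p) (x : Bundle n p) : Set (Bundle n p) :=
  {y | pref.better y x} ∪ {x}

open Classical in
/-- The cumulative share of agent `j` over the upper contour set of `x`. -/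
noncomputable def cumShare {n p : ℕ} (R : Profile n p) (P : ShareMatrix n p)
    (j : Fin n) (x : Bundle n p) : ℝ :=
  ∑ y with y ∈ upperContour (R j) x, P j y

/-! ### Leximin-optimality -/

/-- The components of `u` rearranged in ascending order. -/
noncomputable def sortAsc {ι : Type} [Fintype ι] (u : ι → ℝ) : Fin (Fintype.card ι) → ℝ :=
  (u ∘ (Fintype.equivFin ι).symm) ∘ Tuple.sort (u ∘ (Fintype.equivFin ι).symm)

/-- Lexicographic dominance of vectors. -/
def LexDom {k : ℕ} (a b : Fin k → ℝ) : Prop :=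
  ∃ i, a i > b i ∧ ∀ l, l < i → a l ≥ b l

/-- The leximin relation: the sorted `u` lexicographically dominates the sorted `v`. -/
def Leximin {ι : Type} [Fintype ι] (u v : ι → ℝ) : Prop :=
  LexDom (sortAsc u) (sortAsc v)

/-- The vector of all cumulative shares, indexed by agents and bundles. -/
noncomputable def cumVector {n p : ℕ} (R : Profile n p) (P : ShareMatrix n p) :
    Fin n × Bundle n p → ℝ :=
  fun jx => cumShare R P jx.1 jx.2

/-- `P` leximin-dominates every other fractional assignment. -/
def IsLeximinOptimal {n p : ℕ} (R : Profile n p) (P : ShareMatrix n p) : Prop :=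
  ∀ Q, IsAssignment Q → Q ≠ P → Leximin (cumVector R P) (cumVector R Q)

/-- A mechanism satisfies leximin-optimality if all its outputs are leximin-optimal. -/
def LeximinOptimality {n p : ℕ} (f : Profile n p → ShareMatrix n p) : Prop :=
  ∀ R, IsLeximinOptimal R (f R)

/-! ### Item-wise ordinal fairness -/

/-- Every bundle `x` has, for every agent `j`, an item `o` such that every agent `k` who receives
a positive share of a bundle `y` containing `o` has a cumulative share at `y` that is at most the
cumulative share of `j` at `x`. The agent `j` need not receive a positive share of `x`. -/
def IsItemwiseOrdinallyFair {n p : ℕ} (R : Profile n p) (P : ShareMatrix n p) : Prop :=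
  ∀ j x, ∃ o, Contains x o ∧
    ∀ k y, Contains y o → 0 < P k y → cumShare R P k y ≤ cumShare R P j x

/-- A mechanism satisfies item-wise ordinal fairness if all its outputs do. -/
def ItemwiseOrdinalFairness {n p : ℕ} (f : Profile n p → ShareMatrix n p) : Prop :=
  ∀ R, IsItemwiseOrdinallyFair R (f R)

/-! ### The multi-type probabilistic serial mechanism -/

/-- The state of the algorithm between two rounds. -/
structure State (n p : ℕ) where
  /-- the unexhausted items -/
  remaining : Finset (Item n p)
  /-- the supply that is left of each item -/
  supply : Item n p → ℝ
  /-- the shares consumed so far -/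
  shares : ShareMatrix n p

/-- Initially nothing is consumed and one unit of every item is left. -/
def initState (n p : ℕ) : State n p where
  remaining := Finset.univ
  supply := fun _ => 1
  shares := fun _ _ => 0

/-- A bundle is available if all of its items are unexhausted. -/
def Available {n p : ℕ} (S : State n p) (x : Bundle n p) : Prop :=
  ∀ o, Contains x o → o ∈ S.remaining

/-- `x` is the most preferred available bundle of agent `j`. -/
def IsTop {n p : ℕ} (R : Profile n p) (S : State n p) (j : Fin n) (x : Bundle n p) : Prop :=
  Available S x ∧ ∀ y, Available S y → y ≠ x → (R j).better x y

open Classical in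
/-- The number of agents whose top bundle contains `o`, i.e. the rate at which `o` is consumed. -/
noncomputable def consumers {n p : ℕ} (R : Profile n p) (S : State n p) (o : Item n p) : ℕ :=
  Finset.card {j : Fin n | ∃ x, IsTop R S j x ∧ Contains x o}

/-- The time needed to exhaust `o` at the current rate (meaningful if `o` has a consumer). -/
noncomputable def exhaustTime {n p : ℕ} (R : Profile n p) (S : State n p) (o : Item n p) : ℝ :=
  S.supply o / consumers R S o

/-- The duration of the round: the least time in which some unexhausted item that is being
consumed becomes exhausted. Items without consumers count as infinite, so they are left out. -/
noncomputable def progress {n p : ℕ} (R : Profile n p) (S : State n p) : ℝ :=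
  sInf (exhaustTime R S '' {o | o ∈ S.remaining ∧ 0 < consumers R S o})

open Classical in
/-- One round: every agent consumes her top bundle at unit rate until a consumed item is
exhausted; the items exhausted in this way are removed. -/
noncomputable def round {n p : ℕ} (R : Profile n p) (S : State n p) : State n p where
  remaining := S.remaining.filter
    (fun o => ¬ (0 < consumers R S o ∧ exhaustTime R S o = progress R S))
  supply := fun o =>
    if o ∈ S.remaining then S.supply o - progress R S * consumers R S o else S.supply o
  shares := fun j x => if IsTop R S j x then S.shares j x + progress R S else S.shares j x

open Classical in
/-- The body of the loop `while S.remaining ≠ ∅`; it does nothing once the loop has ended. -/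
noncomputable def loopStep {n p : ℕ} (R : Profile n p) (S : State n p) : State n p :=
  if S.remaining = ∅ then S else round R S

/-- The state after as many rounds as there are items. Every round exhausts an item, so the loop
has ended by then. -/
noncomputable def finalState {n p : ℕ} (R : Profile n p) : State n p :=
  (loopStep R)^[Fintype.card (Item n p)] (initState n p)

/-- The multi-type probabilistic serial mechanism. -/
noncomputable def mps (n p : ℕ) (R : Profile n p) : ShareMatrix n p :=
  (finalState R).shares

end MTAP

namespace MTAP

open Classical

variable {n p : ℕ}

/-! ### Finite linear preferences -/

/-! Everything reduces to one implication: a fair assignment is leximin-optimal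
(`IsItemwiseOrdinallyFair.isLeximinOptimal`). Domination is asymmetric, so at most one assignment is
leximin-optimal; once the output of MPS is shown fair, both characterizations follow. For the
implication, let `α` be the least cumulative share of `P` at which `Q` differs. If `Q` differs
somewhere with a value below `α`, then `P` dominates by counting (`leximin_of_agree_below`).
Otherwise fairness at a pair of value `α` gives an item all of whose positive shares under `P` sit
at cumulative shares at most `α`; there `Q` gives at least as much, and unit supply forces equality,
a contradiction. Fairness of MPS is carried through the rounds by `RunInvariant.round`: exhausting
an item freezes the shares of all bundles containing it. -/

theorem Preference.wellFounded_better (r : Preference n p) : WellFounded r.better :=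
  haveI : IsTrans _ r.better := ⟨r.trans⟩
  haveI : Std.Irrefl r.better := ⟨r.irrefl⟩
  Finite.wellFounded_of_trans_of_irrefl _

/-- The preference with the reversed order. -/
def Preference.dual (r : Preference n p) : Preference n p where
  better x y := r.better y x
  irrefl := r.irrefl
  trans _ _ _ h h' := r.trans _ _ _ h' h
  total x y h := (r.total x y h).symm

theorem Preference.asymm (r : Preference n p) {x y : Bundle n p} (h : r.better x y) :
    ¬ r.better y x := fun h' => r.irrefl _ (r.trans _ _ _ h h')

theorem mem_upperContour {r : Preference n p} {x y : Bundle n p} :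
    y ∈ upperContour r x ↔ y = x ∨ r.better y x := by
  simp [upperContour]

theorem not_mem_upperContour {r : Preference n p} {x y : Bundle n p} :
    y ∉ upperContour r x ↔ r.better x y := by
  rw [mem_upperContour, not_or]
  constructor
  · rintro ⟨h, h'⟩
    exact (r.total x y (Ne.symm h)).resolve_right h'
  · intro h
    exact ⟨fun e => r.irrefl y (e ▸ h), r.asymm h⟩

/-- A bundle is either the best one or has an immediate predecessor. -/
theorem Preference.isBest_or_exists_pred (r : Preference n p) (x : Bundle n p) :
    (∀ y, ¬ r.better y x) ∨ ∃ z, r.better z x ∧ ∀ y, r.better y x ↔ y ∈ upperContour r z := by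
  by_cases h : ∃ y, r.better y x
  · right
    obtain ⟨z, hz, hmin⟩ := r.dual.wellFounded_better.has_min {y | r.better y x} h
    refine ⟨z, hz, fun y => ⟨fun hy => ?_, fun hy => ?_⟩⟩
    · by_contra hn
      exact hmin y hy (show r.better z y from not_mem_upperContour.1 hn)
    · rcases mem_upperContour.1 hy with rfl | hy
      · exact hz
      · exact r.trans _ _ _ hy hz
  · left
    simpa using h

/-! ### Cumulative shares -/

theorem cumShare_eq_add (R : Profile n p) (P : ShareMatrix n p) (j : Fin n) (x : Bundle n p) :
    cumShare R P j x = P j x + ∑ y with (R j).better y x, P j y := by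
  have : Finset.univ.filter (fun y => y ∈ upperContour (R j) x) =
      insert x (Finset.univ.filter fun y => (R j).better y x) := by
    ext y
    simp [mem_upperContour]
  rw [cumShare, this, Finset.sum_insert (by simpa using (R j).irrefl x)]

/-- The bundles strictly better than `x` are either none or the upper contour set of its immediate
predecessor. -/
theorem sum_better_congr {R : Profile n p} {P Q : ShareMatrix n p} {j : Fin n} {x : Bundle n p}
    (h : ∀ z, (R j).better z x → cumShare R P j z = cumShare R Q j z) :
    ∑ y with (R j).better y x, P j y = ∑ y with (R j).better y x, Q j y := by
  rcases (R j).isBest_or_exists_pred x with hx | ⟨z, hz, hzx⟩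
  · simp [hx]
  · have := h z hz
    unfold cumShare at this
    simpa only [hzx] using this

theorem cumShare_le_sub {R : Profile n p} {P : ShareMatrix n p} (h0 : ∀ j x, 0 ≤ P j x)
    {j : Fin n} {x z : Bundle n p} (hz : (R j).better z x) :
    cumShare R P j z ≤ cumShare R P j x - P j x := by
  rw [cumShare_eq_add R P j x, add_sub_cancel_left, cumShare]
  refine Finset.sum_le_sum_of_subset_of_nonneg (fun y => ?_) fun y _ _ => h0 j y
  simp only [Finset.mem_filter, Finset.mem_univ, true_and, mem_upperContour]
  rintro (rfl | h)
  · exact hz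
  · exact (R j).trans _ _ _ h hz

theorem eq_of_cumShare_eq {R : Profile n p} {P Q : ShareMatrix n p}
    (h : ∀ j x, cumShare R P j x = cumShare R Q j x) : P = Q := by
  funext j x
  have h1 := h j x
  rw [cumShare_eq_add, cumShare_eq_add, sum_better_congr fun z _ => h j z] at h1
  exact add_right_cancel h1

/-! ### The leximin relation -/

theorem LexDom.asymm {k : ℕ} {a b : Fin k → ℝ} (h : LexDom a b) : ¬ LexDom b a := by
  rintro ⟨i, hi, hi'⟩
  obtain ⟨l, hl, hl'⟩ := h
  rcases lt_trichotomy i l with h | rfl | h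
  · exact absurd (hl' i h) (not_le.2 hi)
  · exact lt_asymm hi hl
  · exact absurd (hi' l h) (not_le.2 hl)

/-- Turns statements about sorted positions into counts of sublevel sets, so the sorting permutation
need not be handled again. -/
theorem sortAsc_le_iff {ι : Type} [Fintype ι] (u : ι → ℝ) (l : Fin (Fintype.card ι)) (c : ℝ) :
    sortAsc u l ≤ c ↔ (l : ℕ) < Finset.card {i | u i ≤ c} := by
  have hm : Monotone (sortAsc u) := Tuple.monotone_sort _
  have hc : Finset.card {i | u i ≤ c} = Finset.card {l | sortAsc u l ≤ c} := by
    symm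
    exact Finset.card_equiv
      ((Tuple.sort (u ∘ (Fintype.equivFin ι).symm)).trans (Fintype.equivFin ι).symm) fun l => by
        simp only [Finset.mem_filter, Finset.mem_univ, true_and]
        rfl
  rw [hc]
  convert (Tuple.lt_card_le_iff_apply_le_of_monotone hm).symm

/-- If two vectors agree where the first is below `α`, and the second has a component below `α`
where they differ, then the first leximin-dominates the second. -/
theorem leximin_of_agree_below {ι : Type} [Fintype ι] {u v : ι → ℝ} {α : ℝ}
    (hagree : ∀ i, u i < α → u i = v i) {i₀ : ι} (hne : u i₀ ≠ v i₀) (hα : v i₀ < α) :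
    Leximin u v := by
  have hsub : ∀ c ≤ v i₀, (Finset.univ.filter fun i => u i ≤ c) ⊆
      Finset.univ.filter fun i => v i ≤ c := by
    intro c hc i hi
    simp only [Finset.mem_filter, Finset.mem_univ, true_and] at hi ⊢
    rwa [← hagree i (by linarith)]
  have hlt : Finset.card {i | u i ≤ v i₀} < Finset.card {i | v i ≤ v i₀} := by
    refine Finset.card_lt_card ⟨hsub _ le_rfl, fun h => ?_⟩
    have : i₀ ∈ Finset.univ.filter fun i => u i ≤ v i₀ := h (by simp)
    have hu : u i₀ ≤ v i₀ := by simpa using this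
    exact hne (hagree i₀ (by linarith))
  have hcard : Finset.card {i | u i ≤ v i₀} < Fintype.card ι :=
    hlt.trans_le (Finset.card_le_univ _)
  -- Counting from 0, this position holds the first sorted entry of `u` above `v i₀`; `v` has at
  -- least one more entry up to `v i₀`.
  refine ⟨⟨_, hcard⟩, ?_, fun l hl => ?_⟩
  · have h1 : ¬ sortAsc u ⟨_, hcard⟩ ≤ v i₀ := by rw [sortAsc_le_iff]; simp
    have h2 : sortAsc v ⟨_, hcard⟩ ≤ v i₀ := by rw [sortAsc_le_iff]; exact hlt
    exact h2.trans_lt (not_le.1 h1)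
  · have h1 : sortAsc u l ≤ v i₀ := by rw [sortAsc_le_iff]; exact hl
    have h2 := (sortAsc_le_iff u l (sortAsc u l)).1 le_rfl
    exact (sortAsc_le_iff v l _).2 (h2.trans_le (Finset.card_le_card (hsub _ h1)))

theorem IsLeximinOptimal.unique {R : Profile n p} {P Q : ShareMatrix n p}
    (hP : IsAssignment P) (hQ : IsAssignment Q) (hlP : IsLeximinOptimal R P)
    (hlQ : IsLeximinOptimal R Q) : P = Q := by
  by_contra hne
  exact LexDom.asymm (hlP Q hQ (Ne.symm hne)) (hlQ P hP hne)

/-! ### Item-wise ordinal fairness implies leximin-optimality -/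

theorem IsItemwiseOrdinallyFair.isLeximinOptimal {R : Profile n p} {P : ShareMatrix n p}
    (hP : IsAssignment P) (hf : IsItemwiseOrdinallyFair R P) : IsLeximinOptimal R P := by
  intro Q hQ hne
  set D : Finset (Fin n × Bundle n p) :=
    Finset.univ.filter fun jx => cumVector R P jx ≠ cumVector R Q jx with hD
  have hDne : D.Nonempty := by
    by_contra h
    rw [Finset.not_nonempty_iff_eq_empty, hD, Finset.filter_eq_empty_iff] at h
    exact hne (eq_of_cumShare_eq fun j x => not_not.1 (h (Finset.mem_univ (j, x)))).symm
  obtain ⟨⟨j, x₀⟩, hjD, hmin⟩ := D.exists_min_image (cumVector R P) hDne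
  set α := cumShare R P j x₀
  have hagree : ∀ k y, cumShare R P k y < α → cumShare R P k y = cumShare R Q k y := by
    intro k y h
    by_contra hn
    exact absurd (hmin (k, y) (Finset.mem_filter.2 ⟨Finset.mem_univ _, hn⟩)) (not_le.2 h)
  by_cases hex : ∃ k y, cumShare R P k y ≠ cumShare R Q k y ∧ cumShare R Q k y < α
  · obtain ⟨k, y, h1, h2⟩ := hex
    exact leximin_of_agree_below (i₀ := (k, y)) (fun i => hagree i.1 i.2) h1 h2
  exfalso
  push Not at hex
  have hge : ∀ k y, cumShare R P k y ≤ α → cumShare R P k y ≤ cumShare R Q k y := by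
    intro k y h
    by_cases hn : cumShare R P k y = cumShare R Q k y
    · exact hn.le
    · exact h.trans (hex k y hn)
  -- Several bundles of `j` may share the value `α`, since `P` can vanish in between; the best
  -- differing one is needed at the end.
  obtain ⟨x, ⟨hxα, hxne⟩, hbest⟩ := (R j).wellFounded_better.has_min
    {x | cumShare R P j x = α ∧ cumShare R P j x ≠ cumShare R Q j x}
    ⟨x₀, rfl, (Finset.mem_filter.1 hjD).2⟩
  obtain ⟨o, hxo, ho⟩ := hf j x
  have hle : ∀ k y, Contains y o → P k y ≤ Q k y := by
    intro k y hy
    rcases (hP.1 k y).1.eq_or_lt with h0 | hpos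
    · rw [← h0]
      exact (hQ.1 k y).1
    · have h1 := ho k y hy hpos
      have h2 := hge k y (h1.trans hxα.le)
      -- As `P k y > 0`, every better bundle has cumulative share below `α`, where `P` and `Q`
      -- agree.
      rw [cumShare_eq_add, cumShare_eq_add R Q, sum_better_congr fun z hz => hagree k z
        (by linarith [cumShare_le_sub (R := R) (fun j x => (hP.1 j x).1) hz])] at h2
      exact le_of_add_le_add_right h2
  have hsum : ∀ k ∈ Finset.univ, ∑ y with Contains y o, P k y = ∑ y with Contains y o, Q k y :=
    (Finset.sum_eq_sum_iff_of_le fun k _ => Finset.sum_le_sum fun y hy =>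
      hle k y (Finset.mem_filter.1 hy).2).1 ((hP.2.2 o).trans (hQ.2.2 o).symm)
  have heq : P j x = Q j x :=
    (Finset.sum_eq_sum_iff_of_le fun y hy => hle j y (Finset.mem_filter.1 hy).2).1
      (hsum j (Finset.mem_univ j)) x (by simpa using hxo)
  apply hxne
  rw [cumShare_eq_add, cumShare_eq_add R Q, heq, sum_better_congr fun z hz => ?_]
  by_contra hn
  have h1 := cumShare_le_sub (R := R) (fun j x => (hP.1 j x).1) hz
  have h2 := (hP.1 j x).1
  have h3 : cumShare R P j z = α := by
    by_contra h3
    exact hn (hagree j z (lt_of_le_of_ne (by linarith) h3))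
  exact hbest z ⟨h3, hn⟩ hz

/-! ### The run of the multi-type probabilistic serial mechanism -/

/-- What holds after the agents have been consuming for time `T`. -/
structure RunInvariant (R : Profile n p) (S : State n p) (T : ℝ) : Prop where
  share_nonneg : ∀ j x, 0 ≤ S.shares j x
  share_total : ∀ j, ∑ x, S.shares j x = T
  supply_eq : ∀ o, S.supply o = 1 - ∑ j, ∑ x with Contains x o, S.shares j x
  supply_pos : ∀ o ∈ S.remaining, 0 < S.supply o
  supply_zero : ∀ o ∉ S.remaining, S.supply o = 0
  better_unavailable : ∀ j x y, 0 < S.shares j x → (R j).better y x → ¬ Available S y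
  -- The witness is required to be exhausted, so that later rounds cannot add to bundles containing
  -- it.
  fair : ∀ j x, ¬ Available S x → ∃ o, Contains x o ∧ o ∉ S.remaining ∧
    ∀ k y, Contains y o → 0 < S.shares k y → cumShare R S.shares k y ≤ cumShare R S.shares j x

theorem runInvariant_initState (R : Profile n p) : RunInvariant R (initState n p) 0 where
  share_nonneg _ _ := le_rfl
  share_total _ := by simp [initState]
  supply_eq _ := by simp [initState]
  supply_pos _ _ := by simp [initState]
  supply_zero o h := absurd (Finset.mem_univ o) h
  better_unavailable _ _ _ h := absurd h (lt_irrefl _)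
  fair _ _ h := absurd (fun o _ => Finset.mem_univ o) h

theorem sum_contains_eq_sum (P : ShareMatrix n p) (i : Fin p) (j : Fin n) :
    ∑ a, ∑ x with Contains x (i, a), P j x = ∑ x, P j x := by
  convert Finset.sum_fiberwise Finset.univ (fun x : Bundle n p => x i) (P j)
  simp [Contains]

theorem cumShare_le_sum {R : Profile n p} {P : ShareMatrix n p} (h0 : ∀ j x, 0 ≤ P j x)
    (j : Fin n) (x : Bundle n p) : cumShare R P j x ≤ ∑ y, P j y :=
  Finset.sum_le_sum_of_subset_of_nonneg (Finset.subset_univ _) fun y _ _ => h0 j y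

theorem cumShare_eq_sum {R : Profile n p} {P : ShareMatrix n p} {j : Fin n} {x : Bundle n p}
    (h : ∀ y, (R j).better x y → P j y = 0) : cumShare R P j x = ∑ y, P j y := by
  refine Finset.sum_subset (Finset.subset_univ _) fun y _ hy => h y ?_
  exact not_mem_upperContour.1 fun hm => hy (Finset.mem_filter.2 ⟨Finset.mem_univ _, hm⟩)

theorem IsTop.unique {R : Profile n p} {S : State n p} {j : Fin n} {x y : Bundle n p}
    (hx : IsTop R S j x) (hy : IsTop R S j y) : x = y := by
  by_contra hne
  exact (R j).asymm (hx.2 y hy.1 (Ne.symm hne)) (hy.2 x hx.1 hne)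

theorem exists_isTop (R : Profile n p) {S : State n p} (h : ∃ x, Available S x) (j : Fin n) :
    ∃ x, IsTop R S j x := by
  obtain ⟨x, hx, hbest⟩ := (R j).wellFounded_better.has_min {x | Available S x} h
  exact ⟨x, hx, fun y hy hne => ((R j).total x y (Ne.symm hne)).resolve_right (hbest y hy)⟩

namespace RunInvariant

variable {R : Profile n p} {S : State n p} {T : ℝ}

/-- Each bundle uses one item of each type, so the remaining supply is the same for all types, and
all types run out together. -/
theorem sum_supply (h : RunInvariant R S T) (i : Fin p) :
    ∑ a, S.supply (i, a) = n * (1 - T) := by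
  simp only [h.supply_eq, Finset.sum_sub_distrib]
  rw [Finset.sum_comm]
  simp only [sum_contains_eq_sum, h.share_total]
  simp
  ring

theorem supply_nonneg (h : RunInvariant R S T) (o : Item n p) : 0 ≤ S.supply o := by
  by_cases ho : o ∈ S.remaining
  · exact (h.supply_pos o ho).le
  · exact (h.supply_zero o ho).ge

theorem exists_available (h : RunInvariant R S T) (hne : S.remaining.Nonempty) :
    ∃ x, Available S x := by
  obtain ⟨⟨i₀, a₀⟩, ho⟩ := hne
  have hpos : 0 < n * (1 - T) := by
    rw [← h.sum_supply i₀]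
    exact Finset.sum_pos' (fun a _ => h.supply_nonneg _)
      ⟨a₀, Finset.mem_univ _, h.supply_pos _ ho⟩
  have hrem : ∀ i, ∃ a, (i, a) ∈ S.remaining := by
    intro i
    by_contra hn
    push Not at hn
    rw [← h.sum_supply i, Finset.sum_eq_zero fun a _ => h.supply_zero _ (hn a)] at hpos
    exact lt_irrefl _ hpos
  choose x hx using hrem
  refine ⟨x, ?_⟩
  rintro ⟨i, a⟩ hxa
  have : x i = a := hxa
  exact this ▸ hx i

end RunInvariant

/-! ### One round of consumption -/

theorem consumers_eq_card {R : Profile n p} {S : State n p} {top : Fin n → Bundle n p}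
    (htop : ∀ j, IsTop R S j (top j)) (o : Item n p) :
    consumers R S o = Finset.card {j | Contains (top j) o} := by
  unfold consumers
  congr 1
  ext j
  simp only [Finset.mem_filter, Finset.mem_univ, true_and]
  exact ⟨fun ⟨x, hx, hxo⟩ => (htop j).unique hx ▸ hxo, fun h => ⟨_, htop j, h⟩⟩

theorem round_shares {R : Profile n p} {S : State n p} {top : Fin n → Bundle n p}
    (htop : ∀ j, IsTop R S j (top j)) (j : Fin n) (x : Bundle n p) :
    (round R S).shares j x = S.shares j x + if top j = x then progress R S else 0 := by
  have : IsTop R S j x ↔ top j = x := ⟨fun h => (htop j).unique h, fun h => h ▸ htop j⟩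
  simp only [round, this]
  split_ifs <;> simp

theorem sum_round_shares {R : Profile n p} {S : State n p} {top : Fin n → Bundle n p}
    (htop : ∀ j, IsTop R S j (top j)) (j : Fin n) (s : Finset (Bundle n p)) :
    ∑ x ∈ s, (round R S).shares j x =
      ∑ x ∈ s, S.shares j x + if top j ∈ s then progress R S else 0 := by
  simp only [round_shares htop, Finset.sum_add_distrib, Finset.sum_ite_eq]

theorem Available.of_round {R : Profile n p} {S : State n p} {x : Bundle n p}
    (h : Available (round R S) x) : Available S x :=
  fun o ho => (Finset.mem_filter.1 (h o ho)).1

/-- The round ends when some consumed item is exhausted, and no item is over-consumed. -/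
theorem progress_spec {R : Profile n p} {S : State n p}
    (hex : ∃ o ∈ S.remaining, 0 < consumers R S o) :
    (∃ o ∈ S.remaining, 0 < consumers R S o ∧ exhaustTime R S o = progress R S) ∧
    ∀ o ∈ S.remaining, 0 < consumers R S o → progress R S ≤ exhaustTime R S o := by
  set A : Set ℝ := exhaustTime R S '' {o | o ∈ S.remaining ∧ 0 < consumers R S o} with hA
  have hfin : A.Finite := (Set.toFinite _).image _
  have hne : A.Nonempty := by
    obtain ⟨o, h1, h2⟩ := hex
    exact ⟨_, o, ⟨h1, h2⟩, rfl⟩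
  refine ⟨?_, fun o h1 h2 => csInf_le hfin.bddBelow ⟨o, ⟨h1, h2⟩, rfl⟩⟩
  obtain ⟨o, ⟨h1, h2⟩, h3⟩ := hne.csInf_mem hfin
  exact ⟨o, h1, h2, h3⟩

/-- Fairness is the main point: a bundle that becomes unavailable now gives its agent the maximal
share `T + ρ`, and older witnesses persist. -/
theorem RunInvariant.round {R : Profile n p} {S : State n p} {T : ℝ} (h : RunInvariant R S T)
    (hne : S.remaining.Nonempty) :
    RunInvariant R (round R S) (T + progress R S) ∧
      (MTAP.round R S).remaining.card < S.remaining.card := by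
  choose top htop using exists_isTop R (h.exists_available hne)
  have hcons : ∃ o ∈ S.remaining, 0 < consumers R S o := by
    obtain ⟨⟨i, a⟩, -⟩ := hne
    -- The label `a` doubles as an agent, which only serves to show that some agent exists.
    refine ⟨(i, top a i), (htop a).1 _ rfl, ?_⟩
    rw [consumers_eq_card htop, Finset.card_pos]
    exact ⟨a, Finset.mem_filter.2 ⟨Finset.mem_univ _, rfl⟩⟩
  obtain ⟨⟨o₁, ho₁, hc₁, ht₁⟩, hmin⟩ := progress_spec hcons
  set ρ := progress R S with hρ
  have hρpos : 0 < ρ := by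
    rw [← ht₁, exhaustTime]
    exact div_pos (h.supply_pos _ ho₁) (by exact_mod_cast hc₁)
  have hmem : ∀ o, o ∈ (MTAP.round R S).remaining ↔
      o ∈ S.remaining ∧ ¬ (0 < consumers R S o ∧ exhaustTime R S o = ρ) :=
    fun o => Finset.mem_filter
  have hcum : ∀ k y, cumShare R (MTAP.round R S).shares k y =
      cumShare R S.shares k y + if top k ∈ upperContour (R k) y then ρ else 0 := by
    intro k y
    simp only [cumShare, sum_round_shares htop, Finset.mem_filter, Finset.mem_univ, true_and, hρ]
  have hnonneg : ∀ j x, 0 ≤ (MTAP.round R S).shares j x := by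
    intro j x
    rw [round_shares htop]
    have := h.share_nonneg j x
    split_ifs <;> linarith
  have htotal : ∀ j, ∑ x, (MTAP.round R S).shares j x = T + ρ := by
    intro j
    rw [sum_round_shares htop, h.share_total, if_pos (Finset.mem_univ _)]
  have hsupply : ∀ o ∈ S.remaining, consumers R S o ≠ 0 →
      (MTAP.round R S).supply o = consumers R S o * (exhaustTime R S o - ρ) := by
    intro o ho hc
    have hc' : (consumers R S o : ℝ) ≠ 0 := by exact_mod_cast hc
    simp only [MTAP.round, if_pos ho, exhaustTime, ← hρ]
    field_simp
  have hsupply_idle : ∀ o, consumers R S o = 0 → (MTAP.round R S).supply o = S.supply o := by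
    intro o hc
    simp [MTAP.round, hc]
  have hbetter : ∀ j x y, 0 < (MTAP.round R S).shares j x → (R j).better y x →
      ¬ Available S y := by
    intro j x y hpos hy hav
    rw [round_shares htop] at hpos
    by_cases hx : top j = x
    · subst hx
      by_cases hyx : y = top j
      · exact (R j).irrefl _ (hyx ▸ hy)
      · exact (R j).asymm hy ((htop j).2 y hav hyx)
    · rw [if_neg hx, add_zero] at hpos
      exact h.better_unavailable j x y hpos hy hav
  constructor
  · refine ⟨hnonneg, htotal, ?_, ?_, ?_, ?_, ?_⟩
    · intro o
      have hs : ∑ j, ∑ x with Contains x o, (MTAP.round R S).shares j x =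
          ∑ j, ∑ x with Contains x o, S.shares j x + ρ * consumers R S o := by
        simp only [sum_round_shares htop, Finset.sum_add_distrib, Finset.mem_filter,
          Finset.mem_univ, true_and, consumers_eq_card htop, ← hρ]
        rw [← Finset.sum_filter, Finset.sum_const, nsmul_eq_mul, mul_comm]
      rw [hs, ← sub_sub, ← h.supply_eq o]
      by_cases ho : o ∈ S.remaining
      · simp [MTAP.round, ho, hρ]
      · have hc : consumers R S o = 0 := by
          rw [consumers_eq_card htop, Finset.card_eq_zero, Finset.filter_eq_empty_iff]
          exact fun j _ hj => ho ((htop j).1 o hj)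
        simp [MTAP.round, ho, hc]
    · intro o ho
      obtain ⟨ho, hn⟩ := (hmem o).1 ho
      rcases Nat.eq_zero_or_pos (consumers R S o) with hc | hc
      · rw [hsupply_idle o hc]
        exact h.supply_pos o ho
      · rw [hsupply o ho hc.ne']
        have h1 := lt_of_le_of_ne (hmin o ho hc) fun e => hn ⟨hc, e.symm⟩
        exact mul_pos (by exact_mod_cast hc) (sub_pos.2 h1)
    · intro o ho
      by_cases hoS : o ∈ S.remaining
      · have hx : 0 < consumers R S o ∧ exhaustTime R S o = ρ := by
          by_contra hn
          exact ho ((hmem o).2 ⟨hoS, hn⟩)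
        rw [hsupply o hoS hx.1.ne', hx.2, sub_self, mul_zero]
      · simpa [MTAP.round, hoS] using h.supply_zero o hoS
    · exact fun j x y hpos hy hav => hbetter j x y hpos hy hav.of_round
    · intro j x hx
      by_cases hxS : Available S x
      · have hcx : cumShare R (MTAP.round R S).shares j x = T + ρ := by
          rw [cumShare_eq_sum fun y hy => ?_, htotal]
          by_contra hne0
          exact hbetter j y x (lt_of_le_of_ne (hnonneg j y) (Ne.symm hne0)) hy hxS
        simp only [Available, not_forall] at hx
        obtain ⟨o, hxo, ho⟩ := hx
        refine ⟨o, hxo, ho, fun k y _ _ => ?_⟩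
        rw [hcx, ← htotal k]
        exact cumShare_le_sum hnonneg k y
      · obtain ⟨o, hxo, ho, hf⟩ := h.fair j x hxS
        refine ⟨o, hxo, fun hm => ho ((hmem o).1 hm).1, fun k y hy hpos => ?_⟩
        have hyS : ¬ Available S y := fun hav => ho (hav o hy)
        -- The share of `k` at `y` did not grow: `y` was unavailable, and a holder of `y` had no
        -- better bundle available.
        have hnt : top k ∉ upperContour (R k) y := by
          rw [mem_upperContour]
          rintro (he | hb)
          · exact hyS (he ▸ (htop k).1)
          · exact hbetter k y _ hpos hb (htop k).1
        have hne : top k ≠ y := fun he => hnt (mem_upperContour.2 (Or.inl he))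
        rw [round_shares htop, if_neg hne, add_zero] at hpos
        rw [hcum, hcum, if_neg hnt, add_zero]
        refine (hf k y hy hpos).trans (le_add_of_nonneg_right ?_)
        split_ifs
        exacts [hρpos.le, le_rfl]
  · refine Finset.card_lt_card ⟨Finset.filter_subset _ _, fun hsub => ?_⟩
    exact ((hmem o₁).1 (hsub ho₁)).2 ⟨hc₁, ht₁⟩

/-! ### The whole run and its output -/

theorem runInvariant_iterate_loopStep (R : Profile n p) (m : ℕ) :
    (∃ T, RunInvariant R ((loopStep R)^[m] (initState n p)) T) ∧
      ((loopStep R)^[m] (initState n p)).remaining.card ≤ Fintype.card (Item n p) - m := by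
  induction m with
  | zero => exact ⟨⟨0, runInvariant_initState R⟩, Finset.card_le_univ _⟩
  | succ m ih =>
    rw [Function.iterate_succ_apply']
    obtain ⟨⟨T, hT⟩, hcard⟩ := ih
    set S := (loopStep R)^[m] (initState n p)
    by_cases hS : S.remaining = ∅
    · rw [loopStep, if_pos hS]
      exact ⟨⟨T, hT⟩, by simp [hS]⟩
    · rw [loopStep, if_neg hS]
      obtain ⟨h1, h2⟩ := hT.round (Finset.nonempty_iff_ne_empty.2 hS)
      exact ⟨⟨_, h1⟩, by omega⟩

theorem finalState_remaining (R : Profile n p) : (finalState R).remaining = ∅ := by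
  have := (runInvariant_iterate_loopStep R (Fintype.card (Item n p))).2
  rw [Nat.sub_self] at this
  exact Finset.card_eq_zero.1 (Nat.le_zero.1 this)

theorem runInvariant_finalState (R : Profile n p) : ∃ T, RunInvariant R (finalState R) T :=
  (runInvariant_iterate_loopStep R _).1

theorem isMechanism_mps (hp : 0 < p) : IsMechanism (mps n p) := by
  intro R
  obtain ⟨T, h⟩ := runInvariant_finalState R
  have hsupply : ∀ o, (finalState R).supply o = 0 :=
    fun o => h.supply_zero o (by simp [finalState_remaining])
  have htotal : ∀ j, ∑ x, mps n p R j x = 1 := by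
    intro j
    have h1 := h.sum_supply ⟨0, hp⟩
    have hn : (n : ℝ) ≠ 0 := by exact_mod_cast j.pos.ne'
    simp only [hsupply, Finset.sum_const_zero] at h1
    -- With no supply left, the common type total `n * (1 - T)` vanishes; the agent `j` ensures `n ≠
    -- 0`.
    have h2 : 1 - T = 0 := (mul_eq_zero.1 h1.symm).resolve_left hn
    exact (h.share_total j).trans (by linarith)
  refine ⟨fun j x => ⟨h.share_nonneg j x, ?_⟩, htotal, fun o => ?_⟩
  · rw [← htotal j]
    exact Finset.single_le_sum (fun y _ => h.share_nonneg j y) (Finset.mem_univ x)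
  · exact (sub_eq_zero.1 ((h.supply_eq o).symm.trans (hsupply o))).symm

theorem itemwiseOrdinalFairness_mps (hp : 0 < p) : ItemwiseOrdinalFairness (mps n p) := by
  intro R j x
  obtain ⟨T, h⟩ := runInvariant_finalState R
  -- Since `p > 0`, each bundle contains an item; an empty bundle would be vacuously available.
  have hx : ¬ Available (finalState R) x := by
    intro hav
    have := hav (⟨0, hp⟩, x ⟨0, hp⟩) rfl
    simp [finalState_remaining] at this
  obtain ⟨o, hxo, -, hf⟩ := h.fair j x hx
  exact ⟨o, hxo, hf⟩

end MTAP

theorem mainTheorem4 (n p : ℕ) (hp : 0 < p) :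
    (∀ R : MTAP.Profile n p, (MTAP.finalState R).remaining = ∅) ∧
    MTAP.IsMechanism (MTAP.mps n p) ∧
    (∀ f : MTAP.Profile n p → MTAP.ShareMatrix n p, MTAP.IsMechanism f →
      (MTAP.LeximinOptimality f ↔ f = MTAP.mps n p)) ∧
    (∀ f : MTAP.Profile n p → MTAP.ShareMatrix n p, MTAP.IsMechanism f →
      (MTAP.ItemwiseOrdinalFairness f ↔ f = MTAP.mps n p)) := by
  have hmech := MTAP.isMechanism_mps (n := n) hp
  have hfair := MTAP.itemwiseOrdinalFairness_mps (n := n) hp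
  have hlex : MTAP.LeximinOptimality (MTAP.mps n p) :=
    fun R => (hfair R).isLeximinOptimal (hmech R)
  have huniq : ∀ f : MTAP.Profile n p → MTAP.ShareMatrix n p, MTAP.IsMechanism f →
      MTAP.LeximinOptimality f → f = MTAP.mps n p :=
    fun f hf hl => funext fun R => (hl R).unique (hf R) (hmech R) (hlex R)
  refine ⟨MTAP.finalState_remaining, hmech, fun f hf => ⟨huniq f hf, ?_⟩,
    fun f hf => ⟨fun h => huniq f hf fun R => (h R).isLeximinOptimal (hf R), ?_⟩⟩
  · rintro rfl
    exact hlex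
  · rintro rfl
    exact hfair
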